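/- In this statement a \emph{graph} is a finite, connected multigraph without loop edges (with at least one vertex); $V(G)$ and $E(G)$ denote its sets of vertices and edges, and $x\in e$ means that the vertex $x$ is an end of the edge $e$. A \emph{cut} of a graph $G$ is the set of all edges connecting a vertex in $V_1$ to a vertex in $V_2$, for some partition of $V(G)$ into disjoint (possibly empty) subsets $V_1,V_2$. An \emph{Eulerian cut} is a non-empty cut $S$ such that every vertex of $G$ is incident to an even number of edges of $S$. A \emph{morphism} $\phi:G\to G'$ of graphs is a function $\phi:V(G)\cup E(G)\to V(G')\cup E(G')$ with $\phi(V(G))\subseteq V(G')$ such that for every edge $e\in E(G)$ with ends $x,y$, either $\phi(e)\in E(G')$ and $\phi(e)$ has ends $\phi(x),\phi(y)$, or $\phi(e)=\phi(x)=\phi(y)$. The morphism $\phi$ is \emph{harmonic} if for every $x\in V(G)$ the quantity $|\{e\in E(G): x\in e,\ \phi(e)=e'\}|$ is the same for all edges $e'\in E(G')$ with $\phi(x)\in e'$. It is \emph{non-constant} if it is not constant as a function on $V(G)\cup E(G)$. Let $B_2$ be the graph consisting of two vertices connected by two edges, and let $\kappa_G$ be the number of spanning trees of $G$, that is, of subgraphs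 of $G$ with vertex set $V(G)$ that are connected and contain no cycle (two parallel edges form a cycle). \textbf{Theorem.} Let $G$ be a graph. Then the following are equivalent: \begin{enumerate} \item $G$ has an Eulerian cut. \item There is a non-constant harmonic morphism from $G$ to $B_2$. \item $\kappa_G$ is even. \end{enumerate} -/

import Mathlib

namespace Graph

section

variable {α β α' β' : Type*}

/-- A multigraph is connected if it has a vertex and any two of its vertices are joined by a
sequence of successively adjacent vertices. -/
def IsConnected (G : Graph α β) : Prop :=
  V(G).Nonempty ∧ ∀ x ∈ V(G), ∀ y ∈ V(G), Relation.ReflTransGen G.Adj x y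

/-- `v 0, e 0, v 1, e 1, …, e (n - 1), v n = v 0` is a cycle of length `n ≥ 1` in `G`: its vertices
`v 0, …, v (n - 1)` are distinct, its edges `e 0, …, e (n - 1)` are distinct, and `e i` joins `v i`
to `v (i + 1)`.  (For `n = 1` this is a loop, for `n = 2` a pair of parallel edges.)
The values of `v` beyond `n` and of `e` beyond `n - 1` are irrelevant. -/
structure IsCycle (G : Graph α β) (n : ℕ) (v : ℕ → α) (e : ℕ → β) : Prop where
  pos : 0 < n
  closed : v n = v 0
  isLink : ∀ i < n, G.IsLink (e i) (v i) (v (i + 1))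
  vertex_injOn : Set.InjOn v (Set.Iio n)
  edge_injOn : Set.InjOn e (Set.Iio n)

/-- A tree is a connected multigraph without cycles. -/
def IsTree (G : Graph α β) : Prop :=
  G.IsConnected ∧ ¬ ∃ n v e, G.IsCycle n v e

/-- The number of spanning trees: subgraphs with the same vertex set which are trees. -/
noncomputable def numSpanningTrees (G : Graph α β) : ℕ :=
  {T : Graph α β | T ≤s G ∧ T.IsTree}.ncard

/-- The set of all edges connecting a vertex in `X` to a vertex outside `X`. -/
def cutEdges (G : Graph α β) (X : Set α) : Set β :=
  {e | ∃ x ∈ X, ∃ y ∈ V(G) \ X, G.IsLink e x y}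

/-- A cut is the set of all edges connecting the two parts of a partition of the vertex set
into two sets. -/
def IsCut (G : Graph α β) (S : Set β) : Prop :=
  ∃ X ⊆ V(G), S = G.cutEdges X

/-- An Eulerian cut of a (loopless) multigraph: a non-empty cut such that every vertex is incident
to an even number of its edges. -/
def IsEulerianCut (G : Graph α β) (S : Set β) : Prop :=
  G.IsCut S ∧ S.Nonempty ∧ ∀ x ∈ V(G), Even {e ∈ S | G.Inc e x}.ncard

/-- A morphism of multigraphs maps vertices to vertices, and maps an edge with ends `x`, `y` either
to an edge whose ends are the images of `x` and `y`, or to the common image of `x` and `y`. -/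
structure Morphism (G : Graph α β) (G' : Graph α' β') where
  onVertex : V(G) → V(G')
  onEdge : E(G) → V(G') ⊕ E(G')
  map_ends : ∀ (e : E(G)) (x y : V(G)), G.IsLink e x y →
    (∃ e' : E(G'), onEdge e = Sum.inr e' ∧ G'.IsLink e' (onVertex x) (onVertex y)) ∨
      (onEdge e = Sum.inl (onVertex x) ∧ onEdge e = Sum.inl (onVertex y))

namespace Morphism

variable {G : Graph α β} {G' : Graph α' β'}

/-- The function on the disjoint union of vertices and edges underlying a morphism. -/
def toFun (φ : Morphism G G') : V(G) ⊕ E(G) → V(G') ⊕ E(G') :=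
  Sum.elim (fun x => Sum.inl (φ.onVertex x)) φ.onEdge

def IsNonConstant (φ : Morphism G G') : Prop :=
  ∃ a b, φ.toFun a ≠ φ.toFun b

/-- A morphism `φ` is harmonic if for every vertex `x` the number of edges at `x` lying over `e'`
is the same for all edges `e'` at `φ x`. -/
def IsHarmonic (φ : Morphism G G') : Prop :=
  ∀ (x : V(G)) (e₁ e₂ : E(G')), G'.Inc e₁ (φ.onVertex x) → G'.Inc e₂ (φ.onVertex x) →
    {e : E(G) | G.Inc e x ∧ φ.onEdge e = Sum.inr e₁}.ncard =
      {e : E(G) | G.Inc e x ∧ φ.onEdge e = Sum.inr e₂}.ncard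

end Morphism

end

/-- The graph with two vertices connected by two edges. -/
def B₂ : Graph (Fin 2) (Fin 2) := Graph.banana 0 1 Set.univ

end Graph

/-!
Spanning trees are counted modulo 2 by linear algebra over `ZMod 2`. Fix a root `r` and let `N` be
the incidence matrix of `G` over `ZMod 2` with the row of `r` deleted; over this field no
orientation of the edges is needed.

A set `F` of edges is the edge set of a spanning tree exactly if the columns of `N` in `F` are a
basis of the column space (`Graph.isTree_restrict_iff`). Indeed the columns span if and only if `F`
connects all vertices, a cycle gives columns with sum zero, and a column lying in the span of the
others belongs to an edge whose ends are connected by the other edges, which closes a cycle. Hence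
the Cauchy–Binet formula (`Matrix.det_mul_eq_sum_card_eq`) shows that the number of spanning trees
is congruent to `det (N * Nᵀ)` modulo 2 (`Graph.numSpanningTrees_eq_det`). So this number is even
if and only if `N * Nᵀ`, the reduced Laplacian modulo 2, has a nonzero kernel vector. Such a vector
is the indicator function of a set `X` of vertices avoiding `r`, and it lies in the kernel if and
only if every vertex other than `r` is incident to an even number of edges of the cut defined by
`X` (`Graph.laplacian_mulVec_indicator`). The handshake lemma extends this to `r`, which gives an
Eulerian cut (`Graph.exists_isEulerianCut_iff_det_eq_zero`).

For a harmonic morphism to `B₂`, the edges that are not contracted form the cut between the two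
vertex fibres, and at every vertex half of them lie over each edge of `B₂`. Conversely an Eulerian
cut is a bipartite multigraph with even degrees, and a morphism is obtained from a 2-colouring of
its edges that is balanced at every vertex (`exists_balanced_coloring`). To find one, pair off the
edges at each vertex. This gives two fixed-point-free involutions of the edge set, one for each side
of the cut, and any 2-colouring in which both involutions change all colours is balanced.
-/

/-! ### The Cauchy–Binet formula -/

namespace Matrix

open Finset Equiv

variable {m n R : Type*} [Fintype m] [Fintype n] [DecidableEq n] [CommRing R]

/-- Expansion of `det (A * B)` by multilinearity of the determinant in the rows. -/
theorem det_mul_eq_sum_fun (A : Matrix n m R) (B : Matrix m n R) :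
    (A * B).det = ∑ f : n → m, (∏ i, A i (f i)) * (B.submatrix f id).det := by
  have h : A * B = fun i => ∑ j, A i j • B j := by
    ext i k
    simp [Matrix.mul_apply, Finset.sum_apply]
  change detRowAlternating (A * B) = _
  rw [h]
  change (detRowAlternating (R := R) (n := n)).toMultilinearMap _ = _
  rw [MultilinearMap.map_sum]
  refine Finset.sum_congr rfl fun f _ => ?_
  rw [MultilinearMap.map_smul_univ]
  rfl

/-- The Cauchy–Binet formula. The bijection `g F` lists the elements of the set `F` of `card n`
indices; the summand does not depend on the listing. -/
theorem det_mul_eq_sum_card_eq [DecidableEq m] (A : Matrix n m R) (B : Matrix m n R)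
    (g : ∀ F : {F : Finset m // F.card = Fintype.card n}, n ≃ F.1) :
    (A * B).det = ∑ F : {F : Finset m // F.card = Fintype.card n},
      (A.submatrix id fun i => (g F i : m)).det * (B.submatrix (fun i => (g F i : m)) id).det := by
  rw [det_mul_eq_sum_fun, ← Finset.sum_subset (filter_subset Function.Injective univ)]
  · rw [← Finset.sum_fiberwise_of_maps_to (t := powersetCard (Fintype.card n) univ)
      (g := fun f : n → m => univ.image f)]
    · rw [Finset.sum_subtype _ (p := fun F : Finset m => F.card = Fintype.card n) (by simp)]
      refine Finset.sum_congr rfl fun F _ => ?_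
      have hinj : Function.Injective fun i => (g F i : m) :=
        Subtype.val_injective.comp (g F).injective
      -- The functions with image `F` are the listing `g F` composed with a permutation.
      rw [← det_transpose, det_apply', Finset.sum_mul]
      symm
      refine Finset.sum_bij (fun σ _ i => (g F (σ i) : m)) ?_ ?_ ?_ ?_
      · intro σ _
        simp only [mem_filter, mem_univ, true_and]
        refine ⟨hinj.comp σ.injective, ?_⟩
        ext e
        simp only [mem_image, mem_univ, true_and]
        exact ⟨by rintro ⟨i, rfl⟩; exact (g F (σ i)).2,
          fun he => ⟨σ.symm ((g F).symm ⟨e, he⟩), by simp⟩⟩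
      · intro σ _ τ _ h
        ext i
        exact hinj (congrFun h i)
      · intro f hf
        simp only [mem_filter, mem_univ, true_and] at hf
        have hmem : ∀ i, f i ∈ F.1 := fun i => hf.2 ▸ mem_image_of_mem _ (mem_univ i)
        have hs_inj : Function.Injective fun i => (g F).symm ⟨f i, hmem i⟩ := fun i j h =>
          hf.1 (congrArg Subtype.val ((g F).symm.injective h))
        refine ⟨Equiv.ofBijective _ (Finite.injective_iff_bijective.1 hs_inj), mem_univ _, ?_⟩
        ext i
        simp
      · intro σ _
        have : B.submatrix (fun i => (g F (σ i) : m)) id =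
          (B.submatrix (fun i => (g F i : m)) id).submatrix σ id := rfl
        rw [this, det_permute]
        simp only [transpose_apply, submatrix_apply, id]
        ring
    · intro f hf
      simp only [mem_filter, mem_univ, true_and] at hf
      simp [mem_powersetCard, card_image_of_injective _ hf]
  · intro f _ hf
    simp only [mem_filter, mem_univ, true_and] at hf
    obtain ⟨i, j, hij, hne⟩ : ∃ i j, f i = f j ∧ i ≠ j := by
      simpa [Function.Injective] using hf
    rw [det_zero_of_row_eq hne (by ext k; simp [hij]), mul_zero]

end Matrix

/-! ### Balanced colourings of bipartite multigraphs -/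

/-- If all fibres of a map on a finite type have even size, their elements can be paired off. -/
theorem exists_involutive_of_even_fibers {S A : Type*} [Finite S] (p : S → A)
    (hp : ∀ a, Even {s | p s = a}.ncard) :
    ∃ i : S → S, Function.Involutive i ∧ (∀ s, i s ≠ s) ∧ ∀ s, p (i s) = p s := by
  classical
  have h : ∀ a, ∃ i : {s // p s = a} → {s // p s = a},
      Function.Involutive i ∧ ∀ s, i s ≠ s := by
    intro a
    obtain ⟨k, hk⟩ := hp a
    have hcard : Nat.card {s // p s = a} = Nat.card (Fin k × Bool) := by
      rw [Nat.card_prod]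
      simp only [Nat.card_eq_fintype_card, Fintype.card_fin, Fintype.card_bool, mul_two]
      exact hk
    obtain ⟨e⟩ := Finite.card_eq.1 hcard
    refine ⟨fun s => e.symm ((e s).1, !(e s).2), fun s => by simp, fun s hs => ?_⟩
    have := congrArg (fun s => (e s).2) hs
    simp at this
  choose i hi hne using h
  have hcongr : ∀ {a b : A} (hab : a = b) (s : S) (ha : p s = a) (hb : p s = b),
      (i a ⟨s, ha⟩ : S) = i b ⟨s, hb⟩ := by
    rintro a _ rfl s _ _
    rfl
  refine ⟨fun s => i (p s) ⟨s, rfl⟩, fun s => ?_, fun s hs => ?_, fun s => (i _ ⟨s, rfl⟩).2⟩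
  · have h1 := (i (p s) ⟨s, rfl⟩).2
    change (i (p (i (p s) ⟨s, rfl⟩)) ⟨i (p s) ⟨s, rfl⟩, rfl⟩ : S) = s
    rw [hcongr h1 _ rfl h1]
    exact congrArg Subtype.val (hi (p s) ⟨s, rfl⟩)
  · exact hne (p s) ⟨s, rfl⟩ (Subtype.ext hs)

/-- Two fixed-point-free involutions have a common proper 2-colouring. The cyclic group generated
by their composition `i ∘ j` has orbits that `i` permutes without fixing any: were `i s` in the
orbit of `s`, then `i` or `j` would fix a point of this orbit. One colour is given to one orbit
out of each pair exchanged by `i`. -/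
theorem exists_coloring_of_involutive {S : Type*} (i j : S → S) (hi : Function.Involutive i)
    (hj : Function.Involutive j) (hi' : ∀ s, i s ≠ s) (hj' : ∀ s, j s ≠ s) :
    ∃ c : S → Fin 2, (∀ s, c (i s) ≠ c s) ∧ ∀ s, c (j s) ≠ c s := by
  classical
  let a : Equiv.Perm S := hi.toPerm
  let b : Equiv.Perm S := hj.toPerm
  have haa : a * a = 1 := Equiv.ext hi
  have hbb : b * b = 1 := Equiv.ext hj
  have hainv : a⁻¹ = a := inv_eq_of_mul_eq_one_left haa
  have hbinv : b⁻¹ = b := inv_eq_of_mul_eq_one_left hbb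
  have hconj : ∀ k : ℤ, a * (a * b) ^ k = (a * b) ^ (-k) * a := by
    intro k
    have h1 : a * (a * b) * a⁻¹ = (a * b)⁻¹ := by
      rw [mul_inv_rev, hainv, hbinv, ← mul_assoc, haa, one_mul]
    have h2 := conj_zpow (i := k) (a := a) (b := a * b)
    rw [h1, inv_zpow, ← zpow_neg] at h2
    rw [h2, mul_assoc, inv_mul_cancel, mul_one]
  have hnot : ∀ s, ¬ (a * b).SameCycle s (a s) := by
    rintro s ⟨k, hk⟩
    obtain ⟨l, rfl | rfl⟩ := Int.even_or_odd' k
    · -- `(a * b) ^ l` carries `s` to a fixed point of `a`.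
      apply hi' (((a * b) ^ l) s)
      change (a * (a * b) ^ l) s = _
      rw [hconj, Equiv.Perm.mul_apply, ← hk, ← Equiv.Perm.mul_apply, ← zpow_add]
      congr 2
      ring
    · -- `(a * b) ^ l` carries `s` to a fixed point of `b`.
      have hb : b * (a * b) ^ l = a * (a * b) ^ (1 + l) := by
        rw [zpow_one_add, ← mul_assoc, ← mul_assoc, haa, one_mul]
      apply hj' (((a * b) ^ l) s)
      change (b * (a * b) ^ l) s = _
      rw [hb, hconj, Equiv.Perm.mul_apply, ← hk,
        ← Equiv.Perm.mul_apply, ← zpow_add]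
      congr 2
      ring
  let Q := Quotient (Equiv.Perm.SameCycle.setoid (a * b))
  let I : Q → Q := Quotient.map a (by
    rintro s t ⟨k, rfl⟩
    refine ⟨-k, ?_⟩
    rw [← Equiv.Perm.mul_apply, ← hconj, Equiv.Perm.mul_apply])
  have hI : ∀ q, I (I q) = q := by
    rintro ⟨s⟩
    exact congrArg (Quotient.mk _) (hi s)
  have hI' : ∀ q, I q ≠ q := by
    rintro ⟨s⟩ h
    exact hnot s (Quotient.exact h).symm
  -- A linear order on the orbits selects one orbit out of each pair `{q, I q}`.
  let _ : LinearOrder Q := linearOrderOfSTO WellOrderingRel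
  let c : S → Fin 2 := fun s => if (Quotient.mk _ s : Q) < I (Quotient.mk _ s) then 0 else 1
  have hc : ∀ s, c (a s) ≠ c s := by
    intro s
    have h1 : (Quotient.mk _ (a s) : Q) = I (Quotient.mk _ s) := rfl
    simp only [c, h1, hI]
    rcases lt_or_gt_of_ne (hI' (Quotient.mk _ s)) with h | h
    · simp [h, h.not_gt]
    · simp [h, h.not_gt]
  refine ⟨c, hc, fun s => ?_⟩
  have h2 : (Quotient.mk _ (a (b s)) : Q) = Quotient.mk _ s :=
    Quotient.sound (show (a * b).SameCycle _ _ from ⟨-1, by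
      rw [← Equiv.Perm.mul_apply, ← Equiv.Perm.mul_apply, zpow_neg_one, mul_assoc,
        inv_mul_cancel]; rfl⟩)
  have h3 : c (a (b s)) = c s := by simp only [c, h2]
  have h4 := hc (b s)
  rw [h3] at h4
  exact h4.symm

theorem ncard_color_eq_of_involutive {S A : Type*} (p : S → A) (c : S → Fin 2) {i : S → S}
    (hi : Function.Involutive i) (hp : ∀ s, p (i s) = p s) (hc : ∀ s, c (i s) ≠ c s) (a : A) :
    {s | p s = a ∧ c s = 0}.ncard = {s | p s = a ∧ c s = 1}.ncard := by
  refine Set.ncard_congr (fun s _ => i s) ?_ (fun s t _ _ h => hi.injective h) ?_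
  · rintro s ⟨h1, h2⟩
    exact ⟨by rw [hp, h1], by have := hc s; omega⟩
  · rintro s ⟨h1, h2⟩
    exact ⟨i s, ⟨by rw [hp, h1], by have := hc s; omega⟩, hi s⟩

/-- The edges of a finite bipartite multigraph all of whose degrees are even can be 2-coloured so
that every vertex is incident to equally many edges of both colours. Here `p` and `q` send an edge
to its ends in the two sides. -/
theorem exists_balanced_coloring {S A B : Type*} [Finite S] (p : S → A) (q : S → B)
    (hp : ∀ a, Even {s | p s = a}.ncard) (hq : ∀ b, Even {s | q s = b}.ncard) :
    ∃ c : S → Fin 2,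
      (∀ a, {s | p s = a ∧ c s = 0}.ncard = {s | p s = a ∧ c s = 1}.ncard) ∧
      ∀ b, {s | q s = b ∧ c s = 0}.ncard = {s | q s = b ∧ c s = 1}.ncard := by
  obtain ⟨i, hi, hi', hip⟩ := exists_involutive_of_even_fibers p hp
  obtain ⟨j, hj, hj', hjq⟩ := exists_involutive_of_even_fibers q hq
  obtain ⟨c, hci, hcj⟩ := exists_coloring_of_involutive i j hi hj hi' hj'
  exact ⟨c, ncard_color_eq_of_involutive p c hi hip hci, ncard_color_eq_of_involutive q c hj hjq hcj⟩

/-! ### Spanning trees as bases -/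

namespace Graph

open Classical in
/-- The unit vector at the vertex `a`, with the coordinate of the root `r` left out; it is zero for
`a = r`. -/
noncomputable def redUnit {α β : Type*} (G : Graph α β) (r a : α) :
    {x // x ∈ V(G) ∧ x ≠ r} → ZMod 2 :=
  fun x => if (x : α) = a then 1 else 0

open Classical in
/-- The column of the edge `e` in the incidence matrix over `ZMod 2`, with the coordinate of the
root `r` left out. -/
noncomputable def redCol {α β : Type*} (G : Graph α β) (r : α) (e : β) :
    {x // x ∈ V(G) ∧ x ≠ r} → ZMod 2 :=
  fun x => if G.Inc e x then 1 else 0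

variable {α β : Type*} {G : Graph α β} {r x y : α} {e : β} {F : Set β}

lemma IsLink.inc_iff (h : G.IsLink e x y) (z : α) : G.Inc e z ↔ z = x ∨ z = y :=
  ⟨fun hz => hz.eq_or_eq_of_isLink h, by rintro (rfl | rfl); exacts [h.inc_left, h.inc_right]⟩

lemma redUnit_self (G : Graph α β) (r : α) : G.redUnit r r = 0 := by
  ext z
  simp [redUnit, z.2.2]

lemma redUnit_eq_single [DecidableEq {x // x ∈ V(G) ∧ x ≠ r}] (hx : x ∈ V(G)) (hxr : x ≠ r) :
    G.redUnit r x = Pi.single ⟨x, hx, hxr⟩ 1 := by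
  ext z
  by_cases hz : (z : α) = x <;> simp [redUnit, Pi.single_apply, Subtype.ext_iff, hz]

lemma IsLink.redCol_eq [G.Loopless] (h : G.IsLink e x y) (r : α) :
    G.redCol r e = G.redUnit r x + G.redUnit r y := by
  ext z
  have hz := h.inc_iff z
  have hne := h.ne
  simp only [redCol, redUnit, Pi.add_apply]
  split_ifs <;> simp_all

lemma IsConnected.span_redCol_eq_top [G.Loopless] [Finite {x // x ∈ V(G) ∧ x ≠ r}]
    (hr : r ∈ V(G)) (h : (G.restrict F).IsConnected) :
    Submodule.span (ZMod 2) (G.redCol r '' F) = ⊤ := by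
  classical
  have key : ∀ a ∈ V(G), G.redUnit r a ∈ Submodule.span (ZMod 2) (G.redCol r '' F) := by
    intro a ha
    induction h.2 r hr a ha with
    | refl => simp [redUnit_self]
    | tail _ hbc ih =>
      obtain ⟨e, he⟩ := hbc
      have he' : e ∈ F ∧ G.IsLink e _ _ := he
      have h1 := he.left_mem
      have h2 := he'.2.redCol_eq r
      rw [← sub_eq_iff_eq_add'] at h2
      rw [← h2]
      exact Submodule.sub_mem _ (Submodule.subset_span ⟨e, he'.1, rfl⟩) (ih h1)
  rw [eq_top_iff, ← (Pi.basisFun (ZMod 2) {x // x ∈ V(G) ∧ x ≠ r}).span_eq, Submodule.span_le]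
  rintro _ ⟨z, rfl⟩
  rw [Pi.basisFun_apply, ← redUnit_eq_single z.2.1 z.2.2]
  exact key z z.2.1

/-- If the component of `r` missed a vertex `a`, then summing the coordinates outside that component
would be a linear form vanishing on all columns in `F` but not at `a`. -/
lemma isConnected_restrict_of_span_redCol_eq_top [G.Loopless] [Finite {x // x ∈ V(G) ∧ x ≠ r}]
    (hr : r ∈ V(G)) (h : Submodule.span (ZMod 2) (G.redCol r '' F) = ⊤) :
    (G.restrict F).IsConnected := by
  classical
  have := Fintype.ofFinite {x // x ∈ V(G) ∧ x ≠ r}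
  let R : α → Prop := Relation.ReflTransGen (G.restrict F).Adj r
  have hsymm : ∀ {a b}, Relation.ReflTransGen (G.restrict F).Adj a b →
      Relation.ReflTransGen (G.restrict F).Adj b a := by
    intro a b hab
    induction hab with
    | refl => exact .refl
    | tail _ h ih => exact .head h.symm ih
  suffices hR : ∀ a ∈ V(G), R a from
    ⟨⟨r, hr⟩, fun a ha b hb => (hsymm (hR a ha)).trans (hR b hb)⟩
  let f : ({x // x ∈ V(G) ∧ x ≠ r} → ZMod 2) →ₗ[ZMod 2] ZMod 2 :=
    Fintype.linearCombination (ZMod 2) (fun x => if R x then 0 else 1)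
  have hf : ∀ a ∈ V(G), f (G.redUnit r a) = if R a then 0 else 1 := by
    intro a ha
    by_cases har : a = r
    · subst har
      rw [redUnit_self, map_zero, if_pos Relation.ReflTransGen.refl]
    · rw [redUnit_eq_single ha har, Fintype.linearCombination_apply_single, one_smul]
  have hf0 : f = 0 := by
    rw [← LinearMap.ker_eq_top, eq_top_iff, ← h, Submodule.span_le]
    rintro _ ⟨e, he, rfl⟩
    by_cases heG : e ∈ E(G)
    · obtain ⟨x, y, hxy⟩ := exists_isLink_of_mem_edgeSet heG
      have hxy' : (G.restrict F).Adj x y := ⟨e, he, hxy⟩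
      have hR : R x ↔ R y := ⟨fun h => h.tail hxy', fun h => h.tail hxy'.symm⟩
      change f _ = 0
      rw [hxy.redCol_eq, map_add, hf x hxy.left_mem, hf y hxy.right_mem, hR]
      exact CharTwo.add_self_eq_zero _
    · have : G.redCol r e = 0 := by
        ext z
        simp [redCol, not_inc_of_notMem_edgeSet heG]
      change f _ = 0
      rw [this, map_zero]
  intro a ha
  by_contra hRa
  simpa [hf0, hRa] using hf a ha

lemma isConnected_restrict_iff_span_redCol_eq_top [G.Loopless]
    [Finite {x // x ∈ V(G) ∧ x ≠ r}] (hr : r ∈ V(G)) :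
    (G.restrict F).IsConnected ↔ Submodule.span (ZMod 2) (G.redCol r '' F) = ⊤ :=
  ⟨fun h => h.span_redCol_eq_top hr, isConnected_restrict_of_span_redCol_eq_top hr⟩

/-- The columns of the edges of a cycle sum to zero. -/
lemma not_linearIndepOn_redCol_of_isCycle [G.Loopless] {n : ℕ} {v : ℕ → α} {c : ℕ → β}
    (h : (G.restrict F).IsCycle n v c) : ¬ LinearIndepOn (ZMod 2) (G.redCol r) F := by
  intro hli
  have hlink : ∀ i < n, c i ∈ F ∧ G.IsLink (c i) (v i) (v (i + 1)) := h.isLink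
  let s : Fin n → F := fun i => ⟨c i, (hlink i i.2).1⟩
  have hs : Function.Injective s := fun i j hij =>
    Fin.ext (h.edge_injOn i.2 j.2 (congrArg Subtype.val hij))
  have hli' := Fintype.linearIndependent_iff.1 (LinearIndependent.comp hli s hs) (fun _ => 1) (by
    simp only [Function.comp, s, one_smul]
    rw [Fin.sum_univ_eq_sum_range (fun i => G.redCol r (c i)) n]
    have : ∀ i ∈ Finset.range n, G.redCol r (c i) =
        G.redUnit r (v (i + 1)) - G.redUnit r (v i) := fun i hi => by
      rw [(hlink i (Finset.mem_range.1 hi)).2.redCol_eq]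
      ext z
      simp [CharTwo.sub_eq_add, add_comm]
    rw [Finset.sum_congr rfl this, Finset.sum_range_sub (fun i => G.redUnit r (v i)), h.closed,
      sub_self])
  exact one_ne_zero (hli' ⟨0, h.pos⟩)

/-- An edge of `F` whose ends are connected by the other edges of `F` lies on a cycle. -/
lemma exists_isCycle_of_reflTransGen [G.Loopless] (he : e ∈ F) (hxy : G.IsLink e x y)
    (h : Relation.ReflTransGen (G.restrict (F \ {e})).Adj x y) :
    ∃ n v c, (G.restrict F).IsCycle n v c := by
  classical
  let H : SimpleGraph α := SimpleGraph.fromRel (G.restrict (F \ {e})).Adj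
  have hH : H.Reachable x y := by
    clear hxy
    induction h with
    | refl => exact .refl _
    | @tail b c _ hbc ih =>
      by_cases hne : b = c
      · rwa [← hne]
      · exact ih.trans (SimpleGraph.Adj.reachable ⟨hne, Or.inl hbc⟩)
  obtain ⟨p, hp⟩ := hH.exists_isPath
  have hinj := hp.getVert_injOn
  have hd : ∀ i, ∃ d, i < p.length → (d ∈ F ∧ d ≠ e) ∧ G.IsLink d (p.getVert i)
      (p.getVert (i + 1)) := by
    intro i
    by_cases hi : i < p.length
    · obtain ⟨-, ⟨d, hd⟩ | ⟨d, hd⟩⟩ := p.adj_getVert_succ hi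
      · exact ⟨d, fun _ => hd⟩
      · exact ⟨d, fun _ => hd.symm⟩
    · exact ⟨e, fun h => absurd h hi⟩
  choose d hd using hd
  -- Consecutive vertices of the path determine the position, so its edges are distinct.
  have hd_inj : ∀ i < p.length, ∀ j < p.length, d i = d j → i = j := by
    intro i hi j hj hij
    have h1 := (hd i hi).2
    rw [hij] at h1
    rcases h1.eq_and_eq_or_eq_and_eq (hd j hj).2 with ⟨h, -⟩ | ⟨h, h'⟩
    · exact hinj (by simp; omega) (by simp; omega) h
    · have e1 := hinj (by simp; omega) (by simp; omega) h
      have e2 := hinj (by simp; omega) (by simp; omega) h'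
      omega
  refine ⟨p.length + 1, fun i => if i ≤ p.length then p.getVert i else x,
    fun i => if i < p.length then d i else e, by omega, by simp, ?_, ?_, ?_⟩
  · intro i hi
    rcases Nat.lt_succ_iff_lt_or_eq.1 hi with h | rfl
    · have h1 : i ≤ p.length := h.le
      have h2 : i + 1 ≤ p.length := h
      simp only [h, h1, h2, if_true]
      exact ⟨(hd i h).1.1, (hd i h).2⟩
    · simpa using ⟨he, hxy.symm⟩
  · intro i hi j hj hij
    have h1 : i ≤ p.length := Nat.lt_succ_iff.1 hi
    have h2 : j ≤ p.length := Nat.lt_succ_iff.1 hj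
    simp only [h1, h2, if_true] at hij
    exact hinj h1 h2 hij
  · intro i hi j hj hij
    rcases Nat.lt_succ_iff_lt_or_eq.1 hi with h1 | rfl <;>
    rcases Nat.lt_succ_iff_lt_or_eq.1 hj with h2 | rfl
    · simp only [h1, h2, if_true] at hij
      exact hd_inj i h1 j h2 hij
    · simp only [h1, if_true, lt_irrefl, if_false] at hij
      exact absurd hij (hd i h1).1.2
    · simp only [h2, if_true, lt_irrefl, if_false] at hij
      exact absurd hij.symm (hd j h2).1.2
    · rfl

/-- A set of edges forms a spanning tree exactly if its columns are a basis. -/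
lemma isTree_restrict_iff [G.Loopless] [Finite {x // x ∈ V(G) ∧ x ≠ r}] (hr : r ∈ V(G))
    (hF : F ⊆ E(G)) : (G.restrict F).IsTree ↔ LinearIndepOn (ZMod 2) (G.redCol r) F ∧
      Submodule.span (ZMod 2) (G.redCol r '' F) = ⊤ := by
  rw [← isConnected_restrict_iff_span_redCol_eq_top hr]
  refine ⟨fun h => ⟨?_, h.1⟩, fun h => ⟨h.2, ?_⟩⟩
  · rw [linearIndepOn_iff_notMem_span]
    intro e he hspan
    obtain ⟨x, y, hxy⟩ := exists_isLink_of_mem_edgeSet (hF he)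
    refine h.2 (exists_isCycle_of_reflTransGen he hxy ?_)
    refine (isConnected_restrict_of_span_redCol_eq_top hr ?_).2 x hxy.left_mem y hxy.right_mem
    have h2 := h.1.span_redCol_eq_top hr
    rw [← h2]
    refine le_antisymm (Submodule.span_mono (Set.image_mono Set.sdiff_subset)) ?_
    rw [Submodule.span_le]
    rintro _ ⟨d, hd, rfl⟩
    by_cases hde : d = e
    · rwa [hde]
    · exact Submodule.subset_span ⟨d, ⟨hd, hde⟩, rfl⟩
  · rintro ⟨n, v, c, hc⟩
    exact not_linearIndepOn_redCol_of_isCycle hc h.1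

/-! ### Counting spanning trees modulo 2 -/

/-- The incidence matrix over `ZMod 2` with the row of the root `r` deleted. -/
noncomputable def redIncMatrix (G : Graph α β) (r : α) :
    Matrix {x // x ∈ V(G) ∧ x ≠ r} E(G) (ZMod 2) :=
  Matrix.of fun x e => G.redCol r e x

/-- A square submatrix of the reduced incidence matrix is regular exactly if its columns belong to
the edges of a spanning tree. -/
lemma det_redIncMatrix_submatrix_ne_zero_iff [G.Loopless] [Fintype {x // x ∈ V(G) ∧ x ≠ r}]
    [DecidableEq {x // x ∈ V(G) ∧ x ≠ r}] (hr : r ∈ V(G)) {g : {x // x ∈ V(G) ∧ x ≠ r} → E(G)}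
    (hg : Function.Injective g) :
    ((G.redIncMatrix r).submatrix id g).det ≠ 0 ↔
      (G.restrict (Set.range fun i => (g i : β))).IsTree := by
  have hg' : Function.Injective fun i => (g i : β) := Subtype.val_injective.comp hg
  rw [isTree_restrict_iff hr (by rintro _ ⟨i, rfl⟩; exact (g i).2), linearIndepOn_range_iff hg',
    ← isUnit_iff_ne_zero, ← Matrix.isUnit_iff_isUnit_det,
    ← Matrix.linearIndependent_cols_iff_isUnit, ← Set.range_comp]
  change LinearIndependent (ZMod 2) (G.redCol r ∘ fun i => (g i : β)) ↔ _
  exact (and_iff_left_of_imp fun h => h.span_eq_top_of_card_eq_finrank' (by simp)).symm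

/-- The number of spanning trees is, modulo 2, the determinant of the reduced Laplacian: in the
Cauchy–Binet expansion of this determinant each spanning tree contributes one and every other set
of edges contributes zero. -/
theorem numSpanningTrees_eq_det [G.Loopless] [Fintype {x // x ∈ V(G) ∧ x ≠ r}] [Fintype E(G)]
    [DecidableEq {x // x ∈ V(G) ∧ x ≠ r}] (hr : r ∈ V(G)) :
    (G.numSpanningTrees : ZMod 2) =
      (G.redIncMatrix r * (G.redIncMatrix r).transpose).det := by
  classical
  let n := {x // x ∈ V(G) ∧ x ≠ r}
  let g : ∀ F : {F : Finset E(G) // F.card = Fintype.card n}, n ≃ F.1 :=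
    fun F => Fintype.equivOfCardEq (by simp [F.2])
  let c : {F : Finset E(G) // F.card = Fintype.card n} → Set β :=
    fun F => Subtype.val '' (F.1 : Set E(G))
  have hc : ∀ F, Set.range (fun i => ((g F i : E(G)) : β)) = c F := by
    intro F
    ext e
    constructor
    · rintro ⟨i, rfl⟩
      exact ⟨_, (g F i).2, rfl⟩
    · rintro ⟨d, hd, rfl⟩
      exact ⟨(g F).symm ⟨d, hd⟩, by simp⟩
  have hcount : G.numSpanningTrees = {F | (G.restrict (c F)).IsTree}.ncard := by
    symm
    refine Set.ncard_congr (fun F _ => G.restrict (c F)) ?_ ?_ ?_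
    · intro F hF
      exact ⟨⟨restrict_le, rfl⟩, hF⟩
    · intro F F' _ _ h
      have h1 : E(G) ∩ c F = E(G) ∩ c F' := congrArg Graph.edgeSet h
      have hsub : ∀ F, c F ⊆ E(G) := by
        rintro F _ ⟨e, -, rfl⟩
        exact e.2
      rw [Set.inter_eq_right.2 (hsub F), Set.inter_eq_right.2 (hsub F')] at h1
      exact Subtype.ext (Finset.coe_injective (Subtype.val_injective.image_injective h1))
    · rintro T ⟨hT, htree⟩
      have hE : E(T) ⊆ E(G) := hT.le.edgeSet_mono
      have hTG : G.restrict E(T) = T := IsSpanningSubgraph.ext_of_edgeSet (G := T)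
        (Set.inter_eq_right.2 hE) ⟨⟨hT.vertexSet_eq.ge, fun e x y h =>
          (hT.le.isLink_iff h.1).2 h.2⟩, hT.vertexSet_eq.symm⟩
      let F : Finset E(G) := {e | (e : β) ∈ E(T)}
      have hF : Subtype.val '' (F : Set E(G)) = E(T) := by
        ext e
        simpa [F] using fun h => hE h
      have hbasis := (isTree_restrict_iff hr hE).1 (hTG.symm ▸ htree)
      have hcard : F.card = Fintype.card n := by
        have hli : LinearIndependent (ZMod 2) fun e : F => G.redCol r e := by
          have h := hbasis.1
          rw [← hF] at h
          exact h.comp (fun e : F => ⟨e, e.1, e.2, rfl⟩) fun e d h =>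
            Subtype.ext (Subtype.ext (Subtype.mk.inj h))
        have hsp : ⊤ ≤ Submodule.span (ZMod 2) (Set.range fun e : F => G.redCol r e) := by
          rw [← hbasis.2, ← hF]
          refine Submodule.span_mono ?_
          rintro _ ⟨_, ⟨e, he, rfl⟩, rfl⟩
          exact ⟨⟨e, he⟩, rfl⟩
        have := Module.finrank_eq_card_basis (Module.Basis.mk hli hsp)
        rw [Module.finrank_fintype_fun_eq_card] at this
        simpa using this.symm
      have hcF : c ⟨F, hcard⟩ = E(T) := hF
      exact ⟨⟨F, hcard⟩, by simpa [hcF, hTG] using htree, by rw [hcF, hTG]⟩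
  rw [Matrix.det_mul_eq_sum_card_eq _ _ g, hcount, Set.ncard_eq_toFinset_card',
    Set.toFinset_ofPred, Finset.natCast_card_filter]
  refine Finset.sum_congr rfl fun F _ => ?_
  have hdet : ((G.redIncMatrix r).transpose.submatrix (fun i => (g F i : E(G))) id).det =
      ((G.redIncMatrix r).submatrix id fun i => (g F i : E(G))).det := by
    rw [← Matrix.det_transpose]
    rfl
  have hiff := det_redIncMatrix_submatrix_ne_zero_iff hr
    (g := fun i => (g F i : E(G))) (Subtype.val_injective.comp (g F).injective)
  rw [hc] at hiff
  rw [hdet]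
  generalize ((G.redIncMatrix r).submatrix id fun i => (g F i : E(G))).det = d at hiff
  simp only [← hiff]
  clear hiff hdet
  revert d
  decide

end Graph

/-! ### Eulerian cuts and the reduced Laplacian -/

namespace Graph

variable {α β : Type*} {G : Graph α β} {r x y : α} {e : β} {X : Set α} {S : Set β}

lemma mem_cutEdges_iff (h : G.IsLink e x y) : e ∈ G.cutEdges X ↔ ¬ (x ∈ X ↔ y ∈ X) := by
  constructor
  · rintro ⟨a, ha, b, ⟨-, hb⟩, hab⟩
    rcases h.eq_and_eq_or_eq_and_eq hab with ⟨rfl, rfl⟩ | ⟨rfl, rfl⟩ <;> tauto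
  · intro hxy
    by_cases hx : x ∈ X
    · exact ⟨x, hx, y, ⟨h.right_mem, by tauto⟩, h⟩
    · exact ⟨y, by tauto, x, ⟨h.left_mem, hx⟩, h.symm⟩

lemma cutEdges_subset : G.cutEdges X ⊆ E(G) := by
  rintro e ⟨x, -, y, -, h⟩
  exact h.edge_mem

lemma cutEdges_diff : G.cutEdges (V(G) \ X) = G.cutEdges X := by
  ext e
  by_cases he : e ∈ E(G)
  · obtain ⟨x, y, h⟩ := exists_isLink_of_mem_edgeSet he
    rw [mem_cutEdges_iff h, mem_cutEdges_iff h]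
    have := h.left_mem
    have := h.right_mem
    simp only [Set.mem_sdiff]
    tauto
  · exact iff_of_false (fun h => he (cutEdges_subset h)) (fun h => he (cutEdges_subset h))

lemma IsConnected.cutEdges_nonempty (hG : G.IsConnected) (hx : x ∈ X) (hxV : x ∈ V(G))
    (hy : y ∈ V(G)) (hyX : y ∉ X) : (G.cutEdges X).Nonempty := by
  by_contra hne
  rw [Set.not_nonempty_iff_eq_empty] at hne
  refine hyX ?_
  induction hG.2 x hxV y hy with
  | refl => exact hx
  | tail _ h ih =>
    obtain ⟨e, he⟩ := h
    have hX := ih he.left_mem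
    by_contra hc
    have : e ∈ G.cutEdges X := (mem_cutEdges_iff he).2 (by tauto)
    simp [hne] at this

lemma natCast_ncard_inc_eq_sum [Fintype E(G)] (hS : S ⊆ E(G)) (x : α) [DecidablePred (· ∈ S)]
    [∀ e, Decidable (G.Inc e x)] :
    (({e ∈ S | G.Inc e x}.ncard : ℕ) : ZMod 2) =
      ∑ e : E(G), (if G.Inc e x then 1 else 0) * (if (e : β) ∈ S then 1 else 0) := by
  have h : {e ∈ S | G.Inc e x} =
      Subtype.val '' {e : E(G) | G.Inc e x ∧ (e : β) ∈ S} := by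
    ext e
    exact ⟨fun h => ⟨⟨e, hS h.1⟩, ⟨h.2, h.1⟩, rfl⟩, by rintro ⟨e, h, rfl⟩; exact ⟨h.2, h.1⟩⟩
  rw [h, Set.ncard_image_of_injective _ Subtype.val_injective, Set.ncard_eq_toFinset_card',
    Set.toFinset_ofPred, Finset.natCast_card_filter]
  refine Finset.sum_congr rfl fun e _ => ?_
  split_ifs <;> simp_all

/-- By the handshake lemma it is enough to check the parity condition of an Eulerian cut away from
one vertex. -/
lemma even_ncard_inc_of_forall_ne [G.Loopless] [Finite V(G)] [Finite E(G)] (hS : S ⊆ E(G))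
    (hr : r ∈ V(G)) (h : ∀ x ∈ V(G), x ≠ r → Even {e ∈ S | G.Inc e x}.ncard) :
    ∀ x ∈ V(G), Even {e ∈ S | G.Inc e x}.ncard := by
  classical
  have := Fintype.ofFinite V(G)
  have := Fintype.ofFinite E(G)
  have hsum : ∑ x : V(G), (({e ∈ S | G.Inc e x}.ncard : ℕ) : ZMod 2) = 0 := by
    simp_rw [natCast_ncard_inc_eq_sum hS]
    rw [Finset.sum_comm]
    refine Finset.sum_eq_zero fun e _ => ?_
    rw [← Finset.sum_mul]
    obtain ⟨x, y, hxy⟩ := exists_isLink_of_mem_edgeSet e.2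
    have hends : ∀ z : V(G), G.Inc e z ↔
        z ∈ ({⟨x, hxy.left_mem⟩, ⟨y, hxy.right_mem⟩} : Finset V(G)) := fun z => by
      simp [hxy.inc_iff, Subtype.ext_iff]
    simp_rw [hends]
    rw [Finset.sum_ite_mem, Finset.univ_inter, Finset.sum_pair (by simpa using hxy.ne)]
    simp [CharTwo.add_self_eq_zero]
  rw [Finset.sum_eq_single (⟨r, hr⟩ : V(G)) ?_ (by simp)] at hsum
  · intro x hx
    by_cases hxr : x = r
    · rw [hxr]
      exact (ZMod.natCast_eq_zero_iff_even).1 hsum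
    · exact h x hx hxr
  · intro x _ hx
    exact (ZMod.natCast_eq_zero_iff_even).2 (h x x.2 fun h => hx (Subtype.ext h))

open Classical in
/-- The reduced Laplacian applied to the indicator function of `X` counts, modulo 2, the cut
edges at each vertex. -/
lemma laplacian_mulVec_indicator [G.Loopless] [Fintype {x // x ∈ V(G) ∧ x ≠ r}] [Fintype E(G)]
    (hr : r ∉ X) (x : {x // x ∈ V(G) ∧ x ≠ r}) :
    ((G.redIncMatrix r * (G.redIncMatrix r).transpose).mulVec
      fun x => if (x : α) ∈ X then 1 else 0) x =
      (({e ∈ G.cutEdges X | G.Inc e x}.ncard : ℕ) : ZMod 2) := by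
  rw [natCast_ncard_inc_eq_sum cutEdges_subset, ← Matrix.mulVec_mulVec]
  refine Finset.sum_congr rfl fun e _ => congrArg _ ?_
  obtain ⟨a, b, hab⟩ := exists_isLink_of_mem_edgeSet e.2
  have hunit : ∀ a ∈ V(G), dotProduct (G.redUnit r a)
      (fun x : {x // x ∈ V(G) ∧ x ≠ r} => if (x : α) ∈ X then (1 : ZMod 2) else 0) =
      if a ∈ X then 1 else 0 := by
    intro a ha
    by_cases har : a = r
    · rw [har, redUnit_self, zero_dotProduct, if_neg hr]
    · rw [redUnit_eq_single ha har, single_dotProduct, one_mul]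
  change dotProduct (G.redCol r e) _ = _
  rw [hab.redCol_eq, add_dotProduct, hunit a hab.left_mem, hunit b hab.right_mem]
  simp only [mem_cutEdges_iff hab]
  by_cases ha : a ∈ X <;> by_cases hb : b ∈ X <;> simp [ha, hb, CharTwo.add_self_eq_zero]

/-- Eulerian cuts correspond to the nonzero vectors in the kernel of the reduced Laplacian
modulo 2. -/
theorem exists_isEulerianCut_iff_det_eq_zero [G.Loopless] [Finite V(G)]
    [Fintype {x // x ∈ V(G) ∧ x ≠ r}] [DecidableEq {x // x ∈ V(G) ∧ x ≠ r}] [Fintype E(G)]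
    (hG : G.IsConnected) (hr : r ∈ V(G)) :
    (∃ S, G.IsEulerianCut S) ↔ (G.redIncMatrix r * (G.redIncMatrix r).transpose).det = 0 := by
  classical
  rw [← Matrix.exists_mulVec_eq_zero_iff]
  constructor
  · rintro ⟨S, ⟨X, hX, rfl⟩, hne, heven⟩
    wlog hrX : r ∉ X generalizing X
    · exact this (V(G) \ X) Set.sdiff_subset (by rwa [cutEdges_diff]) (by rwa [cutEdges_diff])
        (fun h => hrX h.2)
    refine ⟨fun x : {x // x ∈ V(G) ∧ x ≠ r} => if (x : α) ∈ X then 1 else 0, ?_, ?_⟩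
    · obtain ⟨e, x, hx, -⟩ := hne
      intro h
      simpa [hx] using congrFun h ⟨x, hX hx, fun h => hrX (h ▸ hx)⟩
    · ext x
      rw [laplacian_mulVec_indicator hrX]
      exact (ZMod.natCast_eq_zero_iff_even).2 (heven x x.2.1)
  · rintro ⟨f, hf, hLf⟩
    let X : Set α := Subtype.val '' {x | f x = 1}
    have hrX : r ∉ X := by
      rintro ⟨x, -, hx⟩
      exact x.2.2 hx
    have hXV : X ⊆ V(G) := by
      rintro _ ⟨x, -, rfl⟩
      exact x.2.1
    have hfX : f = fun x : {x // x ∈ V(G) ∧ x ≠ r} => if (x : α) ∈ X then 1 else 0 := by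
      ext x
      have : (x : α) ∈ X ↔ f x = 1 := Subtype.val_injective.mem_set_image
      simp only [this]
      generalize f x = d
      revert d
      decide
    obtain ⟨x, hx⟩ := Function.ne_iff.1 hf
    have hxX : (x : α) ∈ X := by
      by_contra h
      rw [hfX] at hx
      simp [h] at hx
    refine ⟨G.cutEdges X, ⟨X, hXV, rfl⟩, hG.cutEdges_nonempty hxX x.2.1 hr hrX, ?_⟩
    refine even_ncard_inc_of_forall_ne cutEdges_subset hr fun x hx hxr => ?_
    rw [← ZMod.natCast_eq_zero_iff_even,
      ← laplacian_mulVec_indicator hrX ⟨x, hx, hxr⟩, ← hfX, hLf]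
    rfl

/-! ### Harmonic morphisms to `B₂` -/

lemma B₂_isLink_iff {e : Fin 2} {x y : Fin 2} : B₂.IsLink e x y ↔ x ≠ y := by
  simp only [B₂, banana_isLink, Set.mem_univ, true_and]
  omega

lemma B₂_inc (e x : Fin 2) : B₂.Inc e x := by
  simp only [B₂, banana_inc, Set.mem_univ, true_and]
  omega

/-- The vertex `i` of `B₂`. -/
def B₂Vertex (i : Fin 2) : V(B₂) := ⟨i, by simp only [B₂, vertexSet_banana]; fin_cases i <;> simp⟩

/-- The edge `i` of `B₂`. -/
def B₂Edge (i : Fin 2) : E(B₂) := ⟨i, Set.mem_univ i⟩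

lemma Morphism.onEdge_eq_inr_iff_onVertex_ne (φ : Morphism G B₂) {e : E(G)} {x y : V(G)}
    (h : G.IsLink e x y) : (∃ e', φ.onEdge e = Sum.inr e') ↔ φ.onVertex x ≠ φ.onVertex y := by
  rcases φ.map_ends e x y h with ⟨e', he', hlink⟩ | ⟨hx, hy⟩
  · rw [B₂_isLink_iff] at hlink
    exact iff_of_true ⟨e', he'⟩ fun h => hlink (congrArg Subtype.val h)
  · exact iff_of_false (by simp [hx]) (not_not.2 (Sum.inl_injective (hx.symm.trans hy)))

/-- A non-constant harmonic morphism to `B₂` yields the Eulerian cut of the edges that are not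
contracted: at each vertex, half of them lie over each edge of `B₂`. -/
theorem exists_isEulerianCut_of_isHarmonic [Finite E(G)] (hG : G.IsConnected)
    {φ : Morphism G B₂} (hφ : φ.IsHarmonic) (hc : φ.IsNonConstant) :
    ∃ S, G.IsEulerianCut S := by
  let X : Set α := Subtype.val '' {x | φ.onVertex x = B₂Vertex 0}
  have hXV : X ⊆ V(G) := by
    rintro _ ⟨x, -, rfl⟩
    exact x.2
  have hX : ∀ x : V(G), (x : α) ∈ X ↔ φ.onVertex x = B₂Vertex 0 := fun x =>
    Subtype.val_injective.mem_set_image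
  have hcut : ∀ e : E(G), (e : β) ∈ G.cutEdges X ↔ ∃ e', φ.onEdge e = Sum.inr e' := by
    intro e
    obtain ⟨x, y, h⟩ := exists_isLink_of_mem_edgeSet e.2
    rw [mem_cutEdges_iff h, hX ⟨x, h.left_mem⟩, hX ⟨y, h.right_mem⟩,
      φ.onEdge_eq_inr_iff_onVertex_ne (x := ⟨x, h.left_mem⟩) (y := ⟨y, h.right_mem⟩) h]
    simp only [Subtype.ext_iff, B₂Vertex, ne_eq]
    omega
  refine ⟨G.cutEdges X, ⟨X, hXV, rfl⟩, ?_, ?_⟩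
  · by_contra hne
    rw [Set.not_nonempty_iff_eq_empty] at hne
    have hvert : ∀ x y : V(G), φ.onVertex x = φ.onVertex y := by
      intro x y
      by_contra hxy
      have hiff : ¬ ((x : α) ∈ X ↔ (y : α) ∈ X) := by
        rw [hX, hX]
        simp only [Subtype.ext_iff, B₂Vertex] at hxy ⊢
        omega
      have hno : ∀ a ∈ V(G), ∀ b ∈ V(G), a ∈ X → b ∉ X → False := fun a ha b hb haX hbX => by
        have := hG.cutEdges_nonempty haX ha hb hbX
        simp [hne] at this
      by_cases hxX : (x : α) ∈ X
      · exact hno x x.2 y y.2 hxX (by tauto)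
      · exact hno y y.2 x x.2 (by tauto) hxX
    obtain ⟨r, hr⟩ := hG.1
    have hconst : ∀ a, φ.toFun a = Sum.inl (φ.onVertex ⟨r, hr⟩) := by
      rintro (x | e)
      · exact congrArg Sum.inl (hvert _ _)
      · obtain ⟨x, y, h⟩ := exists_isLink_of_mem_edgeSet e.2
        rcases φ.map_ends e ⟨x, h.left_mem⟩ ⟨y, h.right_mem⟩ h with ⟨e', he', -⟩ | ⟨h', -⟩
        · have := (hcut e).2 ⟨e', he'⟩
          simp [hne] at this
        · exact h'.trans (congrArg Sum.inl (hvert _ _))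
    obtain ⟨a, b, hab⟩ := hc
    exact hab ((hconst a).trans (hconst b).symm)
  · intro x hx
    have hsplit : {e ∈ G.cutEdges X | G.Inc e x} = Subtype.val ''
        ({e : E(G) | G.Inc e x ∧ φ.onEdge e = Sum.inr (B₂Edge 0)} ∪
          {e : E(G) | G.Inc e x ∧ φ.onEdge e = Sum.inr (B₂Edge 1)}) := by
      ext e
      constructor
      · rintro ⟨he, hinc⟩
        refine ⟨⟨e, cutEdges_subset he⟩, ?_, rfl⟩
        obtain ⟨⟨i, hi⟩, he'⟩ := (hcut ⟨e, cutEdges_subset he⟩).1 he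
        fin_cases i
        · exact Or.inl ⟨hinc, he'⟩
        · exact Or.inr ⟨hinc, he'⟩
      · rintro ⟨e, he | he, rfl⟩
        · exact ⟨(hcut e).2 ⟨_, he.2⟩, he.1⟩
        · exact ⟨(hcut e).2 ⟨_, he.2⟩, he.1⟩
    rw [hsplit, Set.ncard_image_of_injective _ Subtype.val_injective, Set.ncard_union_eq,
      hφ ⟨x, hx⟩ (B₂Edge 0) (B₂Edge 1) (B₂_inc _ _) (B₂_inc _ _)]
    · exact ⟨_, rfl⟩
    · rw [Set.disjoint_left]
      rintro e ⟨-, h1⟩ ⟨-, h2⟩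
      have := Sum.inr_injective (h1.symm.trans h2)
      exact zero_ne_one (congrArg Subtype.val this)

/-- The edges of an Eulerian cut form a bipartite multigraph with even degrees. A balanced
2-colouring of them says which edge of `B₂` each of them is mapped to. -/
theorem exists_isHarmonic_of_isEulerianCut [Finite E(G)] (hS : G.IsEulerianCut S) :
    ∃ φ : Morphism G B₂, φ.IsHarmonic ∧ φ.IsNonConstant := by
  classical
  obtain ⟨⟨X, hXV, rfl⟩, hne, heven⟩ := hS
  have hSE : G.cutEdges X ⊆ E(G) := cutEdges_subset
  have : Finite (G.cutEdges X) := Finite.Set.subset _ hSE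
  have hends : ∀ e : G.cutEdges X, ∃ x ∈ X, ∃ y ∈ V(G) \ X, G.IsLink e x y := fun e => e.2
  choose p hpX q hqX hpq using hends
  have hp : ∀ e (x : α), x ∈ X → (G.Inc e.1 x ↔ p e = x) := by
    intro e x hx
    rw [(hpq e).inc_iff, or_iff_left, eq_comm]
    rintro rfl
    exact (hqX e).2 hx
  have hq : ∀ e (x : α), x ∉ X → (G.Inc e.1 x ↔ q e = x) := by
    intro e x hx
    rw [(hpq e).inc_iff, or_iff_right, eq_comm]
    rintro rfl
    exact hx (hpX e)
  have himage : ∀ x, {e ∈ G.cutEdges X | G.Inc e x} =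
      Subtype.val '' {e : G.cutEdges X | G.Inc e.1 x} := by
    intro x
    ext e
    simp [and_comm]
  have hp_even : ∀ x, Even {e | p e = x}.ncard := by
    intro x
    by_cases hx : x ∈ X
    · simpa [himage, Set.ncard_image_of_injective, Subtype.val_injective, hp _ x hx] using
        heven x (hXV hx)
    · rw [show {e | p e = x} = ∅ from Set.eq_empty_of_forall_notMem fun e he =>
        hx (he ▸ hpX e)]
      simp
  have hq_even : ∀ x, Even {e | q e = x}.ncard := by
    intro x
    by_cases hx : x ∈ V(G) \ X
    · simpa [himage, Set.ncard_image_of_injective, Subtype.val_injective, hq _ x hx.2] using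
        heven x hx.1
    · rw [show {e | q e = x} = ∅ from Set.eq_empty_of_forall_notMem fun e he =>
        hx (he ▸ hqX e)]
      simp
  obtain ⟨c, hcp, hcq⟩ := exists_balanced_coloring p q hp_even hq_even
  let side : α → V(B₂) := fun x => if x ∈ X then B₂Vertex 0 else B₂Vertex 1
  have hside : ∀ {e x y}, G.IsLink e x y → (e ∈ G.cutEdges X ↔ side x ≠ side y) := by
    intro e x y h
    rw [mem_cutEdges_iff h]
    by_cases hx : x ∈ X <;> by_cases hy : y ∈ X <;>
      simp [side, hx, hy, B₂Vertex]
  have hinc : ∀ e : E(G), ∃ x, G.Inc e x := fun e => by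
    obtain ⟨x, y, h⟩ := exists_isLink_of_mem_edgeSet e.2
    exact ⟨x, h.inc_left⟩
  choose a ha using hinc
  let φ : Morphism G B₂ :=
    { onVertex := fun x => side x
      onEdge := fun e => if h : (e : β) ∈ G.cutEdges X then Sum.inr (B₂Edge (c ⟨e, h⟩))
        else Sum.inl (side (a e))
      map_ends := by
        intro e x y h
        by_cases he : (e : β) ∈ G.cutEdges X
        · left
          refine ⟨B₂Edge (c ⟨e, he⟩), by simp [he], ?_⟩
          rw [B₂_isLink_iff]
          exact fun h' => (hside h).1 he (Subtype.ext h')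
        · right
          have hxy : side x = side y := by
            by_contra hne
            exact he ((hside h).2 hne)
          have hax : side (a e) = side x := by
            rcases (ha e).eq_or_eq_of_isLink h with h' | h'
            · rw [h']
            · rw [h', hxy]
          simp [he, hax, hxy] }
  have hcount : ∀ (x : V(G)) (i : Fin 2),
      {e : E(G) | G.Inc e x ∧ φ.onEdge e = Sum.inr (B₂Edge i)}.ncard =
        {e : G.cutEdges X | G.Inc e.1 x ∧ c e = i}.ncard := by
    intro x i
    rw [← Set.ncard_image_of_injective _ (Set.inclusion_injective hSE)]
    congr 1
    ext e
    constructor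
    · rintro ⟨h1, h2⟩
      by_cases he : (e : β) ∈ G.cutEdges X
      · refine ⟨⟨e, he⟩, ⟨h1, ?_⟩, rfl⟩
        have h3 : φ.onEdge e = Sum.inr (B₂Edge (c ⟨e, he⟩)) := dif_pos he
        exact congrArg Subtype.val (Sum.inr_injective (h3.symm.trans h2))
      · simp [φ, he] at h2
    · rintro ⟨e, ⟨h1, h2⟩, rfl⟩
      exact ⟨h1, by simp [φ, h2]⟩
  have hbal : ∀ x : V(G), {e : G.cutEdges X | G.Inc e.1 x ∧ c e = 0}.ncard =
      {e : G.cutEdges X | G.Inc e.1 x ∧ c e = 1}.ncard := by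
    intro x
    by_cases hx : (x : α) ∈ X
    · simpa only [hp _ _ hx] using hcp x
    · simpa only [hq _ _ hx] using hcq x
  refine ⟨φ, ?_, ?_⟩
  · rintro x ⟨i, hi⟩ ⟨j, hj⟩ - -
    have key : ∀ i, {e : G.cutEdges X | G.Inc e.1 x ∧ c e = i}.ncard =
        {e : G.cutEdges X | G.Inc e.1 x ∧ c e = 1}.ncard := by
      intro i
      fin_cases i
      · exact hbal x
      · rfl
    exact (hcount x i).trans ((key i).trans ((key j).symm.trans (hcount x j).symm))
  · obtain ⟨e, x, hx, y, hy, h⟩ := hne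
    refine ⟨Sum.inl ⟨x, h.left_mem⟩, Sum.inl ⟨y, h.right_mem⟩, fun h => ?_⟩
    have : side x = side y := Sum.inl_injective h
    simp [side, hx, hy.2, B₂Vertex] at this

end Graph

theorem mainTheorem4 {α β : Type*} (G : Graph α β) [G.Loopless]
    (hV : G.vertexSet.Finite) (hE : G.edgeSet.Finite) (hG : G.IsConnected) :
    [∃ S : Set β, G.IsEulerianCut S,
      ∃ φ : Graph.Morphism G Graph.B₂, φ.IsHarmonic ∧ φ.IsNonConstant,
      Even G.numSpanningTrees].TFAE := by
  classical
  have : Finite G.vertexSet := hV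
  have : Finite G.edgeSet := hE
  obtain ⟨r, hr⟩ := hG.1
  have : Finite {x // x ∈ G.vertexSet ∧ x ≠ r} := hV.subset fun x hx => hx.1
  have := Fintype.ofFinite {x // x ∈ G.vertexSet ∧ x ≠ r}
  have := Fintype.ofFinite G.edgeSet
  tfae_have 1 → 2 := fun ⟨_, hS⟩ => Graph.exists_isHarmonic_of_isEulerianCut hS
  tfae_have 2 → 1 := fun ⟨_, hφ, hc⟩ => Graph.exists_isEulerianCut_of_isHarmonic hG hφ hc
  tfae_have 1 ↔ 3 := by
    rw [Graph.exists_isEulerianCut_iff_det_eq_zero hG hr, ← Graph.numSpanningTrees_eq_det hr,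
      ZMod.natCast_eq_zero_iff_even]
  tfae_finish
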